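/- Let $T$ be a finite disjoint collection of tetrahedra and let $(M,\mathcal T)$ be the compact triangulated pseudo 3-manifold obtained from $T$ by identifying some of the triangular faces in pairs by affine homeomorphisms. Let $E$ be its set of edges, i.e. the equivalence classes of edges of tetrahedra in $T$, two of them being equivalent if they have the same image in $M$, and let $\Box$ be the set of quads, i.e. of pairs of opposite edges of tetrahedra in $T$ (three quads $q\subset\sigma$ for each $\sigma\in T$). Let $\Lambda(x)=-\int_0^x\ln|2\sin t|\,dt$. An angle assignment is a function $a:\Box\to\mathbb R_{\ge 0}$ with $\sum_{q\subset\sigma}a(q)=\pi$ for all $\sigma\in T$; its volume is $\mathrm{vol}(a)=\sum_{q\in\Box}\Lambda(a(q))$ and its cone angle is the function $k_a\in\mathbb R^E$ for which $k_a(e)$ is the sum of $a(q)$ over all edges of tetrahedra in the class $e$, where $q$ is the quad containing that edge (so $q$ counts twice if both its edges are in the class $e$). For $k\in\mathbb R^E$ let $\mathcal A_k^*$ be the set of angle assignments with cone angle $k$, and let $\mathcal C=\{k\in\mathbb R^E:\mathcal A^*_k\neq\emptyset\}$. For $l\in\mathbb R^E$ (a generalized decorated metric), let $\alpha_l$ be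 the angle assignment whose values at the three quads $q_1,q_2,q_3$ of a tetrahedron are the angles of the generalized Euclidean triangle with side lengths $x_i=e^{(l(e_i)+l(e_i'))/2}$, where $e_i,e_i'$ are the classes of the two edges of $q_i$; here the angle at $q_i$ is the Euclidean angle opposite to the side $x_i$ if the strict triangle inequalities hold, and if $x_i\ge x_j+x_k$ with $\{i,j,k\}=\{1,2,3\}$ then the angles at $q_i,q_j,q_k$ are $\pi,0,0$. The covolume is $$\mathrm{cov}(l)=2\,\mathrm{vol}(\alpha_l)+\sum_{e\in E}l(e)\,k_{\alpha_l}(e).$$ Then $\mathrm{cov}:\mathbb R^E\to\mathbb R$ is $C^1$ and convex. The minimum in $$W(k)=\begin{cases}2\min\{-\mathrm{vol}(a): a\in\mathcal A^*_k\}&\text{if }k\in\mathcal C,\\ +\infty&\text{if }k\notin\mathcal C\end{cases}$$ is attained for every $k\in\mathcal C$, the function $W:\mathbb R^E\to(-\infty,+\infty]$ is convex and lower semi-continuous, and $W$ is the Fenchel dual of $\mathrm{cov}$: $$\sup\{\,l\cdot k-\mathrm{cov}(l): l\in\mathbb R^E\}=W(k)\qquad\text{for all }k\in\mathbb R^E.$$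 -/

import Mathlib

noncomputable section

namespace PseudoThree

/-! ### Triangulated compact pseudo 3-manifolds -/

/-- Gluing data on the disjoint collection of tetrahedra indexed by `T`; the vertices of every
tetrahedron are numbered by `Fin 4`, and face `i` is the face opposite to vertex `i`.
`glue t i = none` means that face `i` of `t` is not identified with any face, and
`glue t i = some (t', π)` means that face `i` of `t` is identified with face `π i` of `t'` by the
affine homeomorphism sending vertex `j` to vertex `π j` for all `j ≠ i`. Faces are identified in
pairs: the identification of the partner is the inverse one, and no face is its own partner. -/
structure Triangulation (T : Type*) where
  glue : T → Fin 4 → Option (T × Equiv.Perm (Fin 4))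
  glue_symm : ∀ t i t' π, glue t i = some (t', π) → glue t' (π i) = some (t, π⁻¹)
  glue_ne : ∀ t i t' π, glue t i = some (t', π) → (t', π i) ≠ (t, i)

/-- The edges of a single tetrahedron: two-element sets of vertices. -/
abbrev TetEdge : Type := {s : Finset (Fin 4) // s.card = 2}

/-- The three quads (pairs of opposite edges) of a single tetrahedron are indexed by `Fin 3`:
the quad `q` consists of the edge `{0, q + 1}` and of the edge opposite to it. -/
def quadFst (q : Fin 3) : TetEdge := ⟨{0, q.succ}, by fin_cases q <;> rfl⟩

/-- The second edge of the quad `q`, opposite to `quadFst q`. -/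
def quadSnd (q : Fin 3) : TetEdge := ⟨{0, q.succ}ᶜ, by fin_cases q <;> rfl⟩

/-- The generalized inner angle opposite to the side `i` of the generalized Euclidean triangle with
positive side lengths `x 0, x 1, x 2`: it is `π` if side `i` is at least the sum of the other two,
`0` if another side is at least the sum of its other two, and otherwise (strict triangle
inequalities) it is the inner angle of the Euclidean triangle with these side lengths, given by the
law of cosines. -/
def genAngle (x : Fin 3 → ℝ) (i : Fin 3) : ℝ :=
  if x (i + 1) + x (i + 2) ≤ x i then Real.pi
  else if x i + x (i + 2) ≤ x (i + 1) ∨ x i + x (i + 1) ≤ x (i + 2) then 0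
  else Real.arccos ((x (i + 1) ^ 2 + x (i + 2) ^ 2 - x i ^ 2) / (2 * x (i + 1) * x (i + 2)))

/-- The Lobachevsky function. -/
def lobachevsky (x : ℝ) : ℝ := -∫ t in (0 : ℝ)..x, Real.log |2 * Real.sin t|

namespace Triangulation

variable {T : Type*}

/-- The elementary identifications of points of the disjoint union of tetrahedra, in barycentric
coordinates. -/
def Glued (𝒯 : Triangulation T) (p p' : (_ : T) × stdSimplex ℝ (Fin 4)) : Prop :=
  ∃ i π, 𝒯.glue p.1 i = some (p'.1, π) ∧ p.2.1 i = 0 ∧ ∀ j, p'.2.1 (π j) = p.2.1 j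

/-- The compact pseudo 3-manifold: the quotient of the disjoint union of the tetrahedra. -/
abbrev Space (𝒯 : Triangulation T) : Type _ := Quot 𝒯.Glued

/-- The image in the quotient space of the edge `s` of the tetrahedron `t`. -/
def edgeImage (𝒯 : Triangulation T) (p : T × TetEdge) : Set 𝒯.Space :=
  {m | ∃ x : stdSimplex ℝ (Fin 4), (∀ j, j ∉ p.2.1 → x.1 j = 0) ∧ Quot.mk 𝒯.Glued ⟨p.1, x⟩ = m}

/-- The edges of the triangulation: the edges of the tetrahedra, two of them being equivalent if
they are mapped to the same set in the quotient space. -/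
def Edge (𝒯 : Triangulation T) : Type _ := Quotient (Setoid.ker 𝒯.edgeImage)

/-- The edge of the triangulation represented by the edge `s` of the tetrahedron `t`. -/
def edge (𝒯 : Triangulation T) (t : T) (s : TetEdge) : 𝒯.Edge :=
  Quotient.mk (Setoid.ker 𝒯.edgeImage) (t, s)

variable [Fintype T]

instance (𝒯 : Triangulation T) : Fintype 𝒯.Edge :=
  haveI : Finite 𝒯.Edge := inferInstanceAs (Finite (Quotient _))
  Fintype.ofFinite _

/-- An angle assignment: a nonnegative function on the quads whose sum over the three quads of
each tetrahedron is `π`. -/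
def IsAngleAssignment (_𝒯 : Triangulation T) (a : T × Fin 3 → ℝ) : Prop :=
  (∀ q, 0 ≤ a q) ∧ ∀ t, ∑ i, a (t, i) = Real.pi

open Classical in
/-- The number of edges in the quad `q` that represent the edge `e` of the triangulation. -/
def incidence (𝒯 : Triangulation T) (q : T × Fin 3) (e : 𝒯.Edge) : ℕ :=
  (if 𝒯.edge q.1 (quadFst q.2) = e then 1 else 0) +
    (if 𝒯.edge q.1 (quadSnd q.2) = e then 1 else 0)

/-- The cone angle: the sum of the angles at all edges of tetrahedra representing `e`. -/
def coneAngle (𝒯 : Triangulation T) (a : T × Fin 3 → ℝ) (e : 𝒯.Edge) : ℝ :=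
  ∑ q, 𝒯.incidence q e * a q

/-- The volume of an angle assignment. -/
def vol (_𝒯 : Triangulation T) (a : T × Fin 3 → ℝ) : ℝ := ∑ q, lobachevsky (a q)

/-- The set of all angle assignments with cone angle `k`. -/
def angleAssignments (𝒯 : Triangulation T) (k : 𝒯.Edge → ℝ) : Set (T × Fin 3 → ℝ) :=
  {a | 𝒯.IsAngleAssignment a ∧ 𝒯.coneAngle a = k}

/-- The set of all cone angles of angle assignments. -/
def coneAngles (𝒯 : Triangulation T) : Set (𝒯.Edge → ℝ) :=
  {k | (𝒯.angleAssignments k).Nonempty}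

/-- The dihedral angles of the generalized decorated metric with edge length function `l`: in each
tetrahedron, the angles of the generalized Euclidean triangle whose side lengths are
`exp ((l e + l e') / 2)` for the three pairs `e, e'` of opposite edges. -/
def dihedral (𝒯 : Triangulation T) (l : 𝒯.Edge → ℝ) (q : T × Fin 3) : ℝ :=
  genAngle (fun i => Real.exp
    ((l (𝒯.edge q.1 (quadFst i)) + l (𝒯.edge q.1 (quadSnd i))) / 2)) q.2

/-- The covolume of a generalized decorated metric. -/
def cov (𝒯 : Triangulation T) (l : 𝒯.Edge → ℝ) : ℝ :=
  2 * 𝒯.vol (𝒯.dihedral l) + ∑ e, l e * 𝒯.coneAngle (𝒯.dihedral l) e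

open Classical in
/-- Twice the minimum of `-vol` over the angle assignments with cone angle `k`, and `+∞` if there
are none. -/
def W (𝒯 : Triangulation T) (k : 𝒯.Edge → ℝ) : EReal :=
  if k ∈ 𝒯.coneAngles then
    ((2 * sInf ((fun a => -𝒯.vol a) '' 𝒯.angleAssignments k) : ℝ) : EReal)
  else ⊤

end Triangulation

/-- The Fenchel dual of an extended-real-valued function on `ℝ^ι`. -/
def fenchelDual {ι : Type*} [Fintype ι] (f : (ι → ℝ) → EReal) (y : ι → ℝ) : EReal :=
  ⨆ x : ι → ℝ, (((∑ i, x i * y i : ℝ) : EReal) - f x)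

/-- Convexity of a function on `ℝ^ι` with values in `(-∞, +∞]`. -/
def IsConvexFun {ι : Type*} (f : (ι → ℝ) → EReal) : Prop :=
  (∀ x, f x ≠ ⊥) ∧ ∀ (x y : ι → ℝ) (a b : ℝ), 0 < a → 0 < b → a + b = 1 →
    f (a • x + b • y) ≤ (a : EReal) * f x + (b : EReal) * f y

end PseudoThree

end

noncomputable section

open Set Filter Topology

namespace PseudoThree

/-! ### The Lobachevsky function -/

/-! The covolume is itself a Legendre transform: `cov l` is the maximum of `2 vol(a) + l · k_a` over
all angle assignments `a`, attained at the dihedral angles of `l`. The functional splits over the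
tetrahedra, so this reduces to one generalized triangle (`idealPairing_le`). For strict triangles it
is the gradient inequality of the concave volume combined with the sine law; degenerate triangles
follow by a limit and a monotonicity argument.

The rest is convex analysis. The cone angle of `dihedral l` is a subgradient of `cov` at `l` and
depends continuously on `l`, so `cov` is convex and C¹. Volume is concave and continuous on a
compact convex set, so `volEpigraph` is closed and convex; Hahn–Banach separation
(`exists_le_sub_cov`) then shows that no duality gap occurs. Finally `W`, as a supremum of
continuous affine functions, is convex and lower semicontinuous. -/

lemma intervalIntegrable_log_abs_two_mul_sin (a b : ℝ) :
    IntervalIntegrable (fun t => Real.log |2 * Real.sin t|) MeasureTheory.volume a b := by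
  have h : MeromorphicOn (fun t => 2 * Real.sin t) (uIcc a b) := by
    intro x _
    exact (analyticAt_const.mul Real.analyticAt_sin).meromorphicAt
  simpa [Real.norm_eq_abs] using h.intervalIntegrable_log_norm

lemma continuous_lobachevsky : Continuous lobachevsky :=
  (intervalIntegral.continuous_primitive intervalIntegrable_log_abs_two_mul_sin 0).neg

lemma hasDerivAt_lobachevsky {x : ℝ} (hx : 0 < Real.sin x) :
    HasDerivAt lobachevsky (-Real.log (2 * Real.sin x)) x := by
  have hc : ContinuousAt (fun t => Real.log |2 * Real.sin t|) x := by
    refine ContinuousAt.log (by fun_prop) ?_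
    positivity
  have := intervalIntegral.integral_hasDerivAt_right
    (intervalIntegrable_log_abs_two_mul_sin 0 x)
    (Measurable.stronglyMeasurable (by fun_prop)).stronglyMeasurableAtFilter hc
  have h := this.neg
  rwa [abs_of_pos (by positivity)] at h

/-! ### The volume of an ideal tetrahedron as a function of its angles -/

/-- The space of angles of a generalized Euclidean triangle. -/
def angleTriangle : Set (Fin 3 → ℝ) := {a | (∀ i, 0 ≤ a i) ∧ ∑ i, a i = Real.pi}

/-- The volume of the generalized ideal tetrahedron with given angles. -/
def idealVol (a : Fin 3 → ℝ) : ℝ := ∑ i, lobachevsky (a i)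

lemma continuous_idealVol : Continuous idealVol :=
  continuous_finsetSum _ fun i _ => continuous_lobachevsky.comp (continuous_apply i)

lemma convex_angleTriangle : Convex ℝ angleTriangle := by
  rintro a ⟨ha, ha'⟩ b ⟨hb, hb'⟩ u v hu hv huv
  refine ⟨fun i => add_nonneg (mul_nonneg hu (ha i)) (mul_nonneg hv (hb i)), ?_⟩
  simp only [Pi.add_apply, Pi.smul_apply, smul_eq_mul, Finset.sum_add_distrib, ← Finset.mul_sum,
    ha', hb', ← add_mul, huv, one_mul]

lemma lt_pi_of_pos {a : Fin 3 → ℝ} (ha : ∀ i, 0 < a i) (hs : ∑ i, a i = Real.pi) (i : Fin 3) :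
    a i < Real.pi := by
  rw [Fin.sum_univ_three] at hs
  have h0 := ha 0
  have h1 := ha 1
  have h2 := ha 2
  fin_cases i <;> simp <;> linarith

/-- The Hessian of the volume is negative semidefinite. -/
lemma sum_sq_mul_cot_nonneg {a d : Fin 3 → ℝ} (ha : ∀ i, 0 < a i) (hs : ∑ i, a i = Real.pi)
    (hd : ∑ i, d i = 0) : 0 ≤ ∑ i, d i ^ 2 * (Real.cos (a i) / Real.sin (a i)) := by
  have hp := fun i => Real.sin_pos_of_pos_of_lt_pi (ha i) (lt_pi_of_pos ha hs i)
  rw [Fin.sum_univ_three] at *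
  have h0 := hp 0
  have h1 := hp 1
  have h2 := hp 2
  have e2 : a 2 = Real.pi - (a 0 + a 1) := by linarith
  have ed : d 2 = -(d 0 + d 1) := by linarith
  rw [e2, Real.sin_pi_sub, Real.sin_add] at h2
  rw [ed, e2, Real.sin_pi_sub, Real.cos_pi_sub, Real.sin_add, Real.cos_add]
  have p0 := Real.sin_sq_add_cos_sq (a 0)
  have p1 := Real.sin_sq_add_cos_sq (a 1)
  set s := Real.sin (a 0)
  set c := Real.cos (a 0)
  set s' := Real.sin (a 1)
  set c' := Real.cos (a 1)
  -- The numerator is `|d₀ sin a₁ - d₁ sin a₀ · exp(i(a₀ + a₁))|²`, split into real and imaginary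
  -- parts.
  have key : d 0 ^ 2 * (c / s) + d 1 ^ 2 * (c' / s') +
      (-(d 0 + d 1)) ^ 2 * (-(c * c' - s * s') / (s * c' + c * s')) =
      ((d 0 * s' - d 1 * s * (c * c' - s * s')) ^ 2 + (d 1 * s * (s * c' + c * s')) ^ 2) /
        (s * s' * (s * c' + c * s')) := by
    field_simp
    have q0 : c ^ 2 = 1 - s ^ 2 := by linarith
    have q1 : c' ^ 2 = 1 - s' ^ 2 := by linarith
    ring_nf
    simp only [q0, q1]
    ring_nf
  rw [key]
  positivity

/-- The gradient inequality for the volume at an interior point of the triangle of angles. -/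
lemma idealVol_le_of_pos {a b : Fin 3 → ℝ} (ha : ∀ i, 0 < a i) (hs : ∑ i, a i = Real.pi)
    (hb : b ∈ angleTriangle) :
    idealVol b ≤ idealVol a + ∑ i, (b i - a i) * -Real.log (2 * Real.sin (a i)) := by
  set d : Fin 3 → ℝ := fun i => b i - a i with hd
  have hd0 : ∑ i, d i = 0 := by simp [hd, hs, hb.2]
  set g : ℝ → ℝ := fun s => ∑ i, lobachevsky (a i + s * d i) with hg
  -- The endpoint `s = 1` is left out: `b` may lie on the boundary, where the derivative of the
  -- Lobachevsky function blows up. Concavity on `[0, 1]` needs only continuity there.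
  have hpos : ∀ s ∈ Ico (0 : ℝ) 1, ∀ i, 0 < a i + s * d i := by
    rintro s ⟨h0, h1⟩ i
    have : a i + s * d i = (1 - s) * a i + s * b i := by simp only [hd]; ring
    rw [this]
    exact add_pos_of_pos_of_nonneg (mul_pos (by linarith) (ha i)) (mul_nonneg h0 (hb.1 i))
  have hsum : ∀ s, ∑ i, (a i + s * d i) = Real.pi := by
    intro s
    rw [Finset.sum_add_distrib, ← Finset.mul_sum, hd0, hs, mul_zero, add_zero]
  have hsin : ∀ s ∈ Ico (0 : ℝ) 1, ∀ i, 0 < Real.sin (a i + s * d i) := fun s h i =>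
    Real.sin_pos_of_pos_of_lt_pi (hpos s h i) (lt_pi_of_pos (hpos s h) (hsum s) i)
  have hlin : ∀ s i, HasDerivAt (fun s => a i + s * d i) (d i) s := fun s i => by
    simpa using ((hasDerivAt_id s).mul_const (d i)).const_add (a i)
  have hg' : ∀ s ∈ Ico (0 : ℝ) 1,
      HasDerivAt g (∑ i, -Real.log (2 * Real.sin (a i + s * d i)) * d i) s := fun s h =>
    HasDerivAt.fun_sum fun i _ =>
      HasDerivAt.comp (h₂ := lobachevsky) s (hasDerivAt_lobachevsky (hsin s h i)) (hlin s i)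
  have hg'' : ∀ s ∈ Ico (0 : ℝ) 1,
      HasDerivAt (fun s => ∑ i, -Real.log (2 * Real.sin (a i + s * d i)) * d i)
        (∑ i, -(2 * (Real.cos (a i + s * d i) * d i) / (2 * Real.sin (a i + s * d i))) * d i) s :=
    fun s h => HasDerivAt.fun_sum fun i _ =>
      ((((hlin s i).sin.const_mul 2).log (mul_pos two_pos (hsin s h i)).ne').fun_neg).mul_const _
  have hconc : ConcaveOn ℝ (Icc 0 1) g := by
    refine concaveOn_of_hasDerivWithinAt2_nonpos (convex_Icc 0 1) ?_
      (f' := fun s => ∑ i, -Real.log (2 * Real.sin (a i + s * d i)) * d i)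
      (f'' := fun s => ∑ i, -(2 * (Real.cos (a i + s * d i) * d i) /
        (2 * Real.sin (a i + s * d i))) * d i) ?_ ?_ ?_
    · refine (continuous_finsetSum _ fun i _ => ?_).continuousOn
      exact continuous_lobachevsky.comp (by fun_prop)
    all_goals
      intro s h
      rw [interior_Icc] at h
      have h' := Ioo_subset_Ico_self h
    · exact (hg' s h').hasDerivWithinAt
    · exact (hg'' s h').hasDerivWithinAt
    · have := sum_sq_mul_cot_nonneg (hpos s h') (hsum s) hd0
      rw [← neg_nonneg, ← Finset.sum_neg_distrib]
      refine this.trans_eq (Finset.sum_congr rfl fun i _ => ?_)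
      rw [mul_div_mul_left _ _ two_ne_zero]
      ring
  have h := hconc.slope_le_of_hasDerivAt (left_mem_Icc.2 zero_le_one)
    (right_mem_Icc.2 zero_le_one) one_pos (hg' 0 (by simp))
  have g1 : g 1 = idealVol b := by simp [hg, hd, idealVol]
  have g0 : g 0 = idealVol a := by simp [hg, idealVol]
  simp only [slope_def_field, g1, g0, sub_zero, div_one, zero_mul, add_zero] at h
  simp only [mul_comm (b _ - a _)]
  linarith

/-- The gradient inequality at `u a + v b` requires an interior point. Boundary points are first
contracted towards the equilateral angles; continuity then removes the contraction. -/
lemma concaveOn_idealVol : ConcaveOn ℝ angleTriangle idealVol := by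
  have pos_case : ∀ a ∈ angleTriangle, ∀ b ∈ angleTriangle, ∀ u v : ℝ, 0 ≤ u → 0 ≤ v →
      u + v = 1 → (∀ i, 0 < a i) → (∀ i, 0 < b i) →
      u * idealVol a + v * idealVol b ≤ idealVol (u • a + v • b) := by
    intro a ha b hb u v hu hv huv pa pb
    have hc := convex_angleTriangle ha hb hu hv huv
    have pc : ∀ i, 0 < (u • a + v • b) i := by
      intro i
      have h1 := pa i
      have h2 := pb i
      simp only [Pi.add_apply, Pi.smul_apply, smul_eq_mul]
      rcases hu.eq_or_lt with rfl | hu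
      · obtain rfl : v = 1 := by linarith
        simpa using h2
      · positivity
    set c := u • a + v • b with hcdef
    have h1 := mul_le_mul_of_nonneg_left (idealVol_le_of_pos pc hc.2 ha) hu
    have h2 := mul_le_mul_of_nonneg_left (idealVol_le_of_pos pc hc.2 hb) hv
    -- The first-order terms cancel because `c` is the barycentre of `a` and `b`.
    have h3 : u * ∑ i, (a i - c i) * -Real.log (2 * Real.sin (c i)) +
        v * ∑ i, (b i - c i) * -Real.log (2 * Real.sin (c i)) = 0 := by
      rw [Finset.mul_sum, Finset.mul_sum, ← Finset.sum_add_distrib]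
      refine Finset.sum_eq_zero fun i _ => ?_
      have : c i = u * a i + v * b i := rfl
      have e : u * (a i - c i) + v * (b i - c i) = 0 := by
        rw [mul_sub, mul_sub, this]
        linear_combination (-(u * a i + v * b i)) * huv
      linear_combination (-Real.log (2 * Real.sin (c i))) * e
    have h4 : (u + v) * idealVol c = idealVol c := by rw [huv, one_mul]
    linarith
  refine ⟨convex_angleTriangle, fun a ha b hb u v hu hv huv => ?_⟩
  set p : Fin 3 → ℝ := fun _ => Real.pi / 3 with hp
  have hpm : p ∈ angleTriangle :=
    ⟨fun i => by positivity, by simp [hp]; ring⟩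
  set f : ℝ → ℝ := fun s => idealVol (u • ((1 - s) • a + s • p) + v • ((1 - s) • b + s • p)) -
    (u * idealVol ((1 - s) • a + s • p) + v * idealVol ((1 - s) • b + s • p)) with hf
  have hfc : Continuous f := by
    have := continuous_idealVol
    fun_prop
  have hev : ∀ᶠ s in 𝓝[>] (0 : ℝ), 0 ≤ f s := by
    filter_upwards [Ioo_mem_nhdsGT (zero_lt_one (α := ℝ))] with s hs
    have hmem : ∀ x ∈ angleTriangle, (1 - s) • x + s • p ∈ angleTriangle := fun x hx =>
      convex_angleTriangle hx hpm (by linarith [hs.2]) hs.1.le (by ring)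
    have hpos : ∀ x ∈ angleTriangle, ∀ i, 0 < ((1 - s) • x + s • p) i := fun x hx i =>
      add_pos_of_nonneg_of_pos (mul_nonneg (by linarith [hs.2]) (hx.1 i))
        (mul_pos hs.1 (by positivity))
    exact sub_nonneg.2 (pos_case _ (hmem a ha) _ (hmem b hb) u v hu hv huv (hpos a ha) (hpos b hb))
  have := ge_of_tendsto (hfc.continuousWithinAt (s := Ioi 0) (x := 0)) hev
  simpa [hf] using this

/-! ### Angles of generalized Euclidean triangles -/

/-- Since `Real.arccos` is constant beyond `[-1, 1]` on either side, the law of cosines covers the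
degenerate cases too. Continuity of the generalized angles comes from this. -/
lemma genAngle_eq_arccos {x : Fin 3 → ℝ} (hx : ∀ i, 0 < x i) (i : Fin 3) :
    genAngle x i =
      Real.arccos ((x (i + 1) ^ 2 + x (i + 2) ^ 2 - x i ^ 2) / (2 * x (i + 1) * x (i + 2))) := by
  have h0 := hx i
  have h1 := hx (i + 1)
  have h2 := hx (i + 2)
  unfold genAngle
  split_ifs with h h'
  · symm
    rw [Real.arccos_eq_pi, div_le_iff₀ (by positivity)]
    nlinarith
  · symm
    rw [Real.arccos_eq_zero, le_div_iff₀ (by positivity)]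
    rcases h' with h' | h' <;> nlinarith
  · rfl

lemma continuous_genAngle_exp :
    Continuous fun y : Fin 3 → ℝ => genAngle fun i => Real.exp (y i / 2) := by
  refine continuous_pi fun i => ?_
  simp only [genAngle_eq_arccos fun i => Real.exp_pos _]
  refine Real.continuous_arccos.comp (Continuous.div (by fun_prop) (by fun_prop) fun y => ?_)
  positivity

/-- Solution of a nondegenerate Euclidean triangle: the inner angles are positive, have sum `π` and
satisfy the sine law. -/
lemma genAngle_of_triangle {x : Fin 3 → ℝ} (hx : ∀ i, 0 < x i)
    (h : ∀ i, x i < x (i + 1) + x (i + 2)) :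
    (∀ i, 0 < genAngle x i) ∧ ∑ i, genAngle x i = Real.pi ∧
      ∃ r : ℝ, 0 < r ∧ ∀ i, Real.sin (genAngle x i) = r * x i := by
  have p0 := hx 0
  have p1 := hx 1
  have p2 := hx 2
  have t0 : x 0 < x 1 + x 2 := h 0
  have t1 : x 1 < x 2 + x 0 := h 1
  have t2 : x 2 < x 0 + x 1 := h 2
  -- By Heron's formula `D` is 16 times the squared area, and `r` below is the reciprocal of the
  -- circumdiameter.
  set D := (x 0 + x 1 + x 2) * (x 1 + x 2 - x 0) * (x 2 + x 0 - x 1) * (x 0 + x 1 - x 2) with hD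
  have hDpos : 0 < D := by
    have := sub_pos.2 t0
    have := sub_pos.2 t1
    have := sub_pos.2 t2
    positivity
  set r := √D / (2 * x 0 * x 1 * x 2) with hr
  have hsq : √D ^ 2 = D := Real.sq_sqrt hDpos.le
  have hrpos : 0 < r := by positivity
  have g0 : genAngle x 0 = Real.arccos ((x 1 ^ 2 + x 2 ^ 2 - x 0 ^ 2) / (2 * x 1 * x 2)) :=
    genAngle_eq_arccos hx 0
  have g1 : genAngle x 1 = Real.arccos ((x 2 ^ 2 + x 0 ^ 2 - x 1 ^ 2) / (2 * x 2 * x 0)) :=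
    genAngle_eq_arccos hx 1
  have g2 : genAngle x 2 = Real.arccos ((x 0 ^ 2 + x 1 ^ 2 - x 2 ^ 2) / (2 * x 0 * x 1)) :=
    genAngle_eq_arccos hx 2
  have c0 : Real.cos (genAngle x 0) = (x 1 ^ 2 + x 2 ^ 2 - x 0 ^ 2) / (2 * x 1 * x 2) := by
    rw [g0, Real.cos_arccos]
    · rw [le_div_iff₀ (by positivity)]; nlinarith
    · rw [div_le_iff₀ (by positivity)]; nlinarith
  have c1 : Real.cos (genAngle x 1) = (x 2 ^ 2 + x 0 ^ 2 - x 1 ^ 2) / (2 * x 2 * x 0) := by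
    rw [g1, Real.cos_arccos]
    · rw [le_div_iff₀ (by positivity)]; nlinarith
    · rw [div_le_iff₀ (by positivity)]; nlinarith
  have c2 : Real.cos (genAngle x 2) = (x 0 ^ 2 + x 1 ^ 2 - x 2 ^ 2) / (2 * x 0 * x 1) := by
    rw [g2, Real.cos_arccos]
    · rw [le_div_iff₀ (by positivity)]; nlinarith
    · rw [div_le_iff₀ (by positivity)]; nlinarith
  have hnn : ∀ i, 0 ≤ genAngle x i := fun i => by
    rw [genAngle_eq_arccos hx]; exact Real.arccos_nonneg _
  have hle : ∀ i, genAngle x i ≤ Real.pi := fun i => by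
    rw [genAngle_eq_arccos hx]; exact Real.arccos_le_pi _
  have hsin : ∀ i, Real.sin (genAngle x i) = r * x i := by
    intro i
    have hnn' := Real.sin_nonneg_of_nonneg_of_le_pi (hnn i) (hle i)
    have hx' := hx i
    rw [← sq_eq_sq₀ hnn' (by positivity), Real.sin_sq, hr, mul_pow, div_pow, hsq, hD]
    fin_cases i
    · simp only [Fin.zero_eta, c0]; field_simp; ring
    · simp only [Fin.mk_one, c1]; field_simp; ring
    · simp only [Fin.reduceFinMk, c2]; field_simp; ring
  have hpos : ∀ i, 0 < genAngle x i := by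
    intro i
    refine (hnn i).lt_of_ne fun h0 => ?_
    have := hsin i
    rw [← h0, Real.sin_zero] at this
    exact (mul_pos hrpos (hx i)).ne this
  refine ⟨hpos, ?_, r, hrpos, hsin⟩
  -- This places `π - (a₀ + a₁)` in `[0, π]`, where cosine is injective, so that comparing cosines
  -- gives the angle sum.
  have hlt : genAngle x 0 < Real.pi - genAngle x 1 := by
    by_contra! hcon
    have := Real.strictAntiOn_cos.antitoneOn ⟨by linarith [hle 1], by linarith [hnn 1]⟩
      ⟨hnn 0, hle 0⟩ hcon
    rw [Real.cos_pi_sub, c0, c1, ← sub_nonneg] at this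
    have e : -((x 2 ^ 2 + x 0 ^ 2 - x 1 ^ 2) / (2 * x 2 * x 0)) -
        (x 1 ^ 2 + x 2 ^ 2 - x 0 ^ 2) / (2 * x 1 * x 2) =
        -((x 0 + x 1) * (x 1 + x 2 - x 0) * (x 2 + x 0 - x 1) / (2 * x 0 * x 1 * x 2)) := by
      field_simp; ring
    rw [e] at this
    have := sub_pos.2 t0
    have := sub_pos.2 t1
    have : 0 < (x 0 + x 1) * (x 1 + x 2 - x 0) * (x 2 + x 0 - x 1) / (2 * x 0 * x 1 * x 2) := by
      positivity
    linarith
  have hcos : Real.cos (genAngle x 2) = Real.cos (Real.pi - (genAngle x 0 + genAngle x 1)) := by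
    rw [Real.cos_pi_sub, Real.cos_add, c0, c1, c2, hsin, hsin]
    have : r * x 0 * (r * x 1) = √D ^ 2 / (4 * x 0 * x 1 * x 2 ^ 2) := by
      rw [hr]; field_simp; ring
    rw [this, hsq, hD]
    field_simp
    ring
  have := Real.injOn_cos ⟨hnn 2, hle 2⟩ ⟨by linarith, by linarith [hnn 0, hnn 1]⟩ hcos
  rw [Fin.sum_univ_three, this]
  ring

lemma sum_fin_three_cyclic (f : Fin 3 → ℝ) (i : Fin 3) : ∑ j, f j = f i + f (i + 1) + f (i + 2) := by
  rw [Fin.sum_univ_three]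
  fin_cases i
  · rfl
  · change _ = f 1 + f 2 + f 0; ring
  · change _ = f 2 + f 0 + f 1; ring

lemma fin_three_add (i : Fin 3) : i + 1 ≠ i ∧ i + 2 ≠ i ∧ i + 2 ≠ i + 1 ∧ i + 1 + 1 = i + 2 ∧
    i + 1 + 2 = i ∧ i + 2 + 1 = i ∧ i + 2 + 2 = i + 1 := by
  revert i
  decide

lemma forall_fin_three_cyclic {p : Fin 3 → Prop} (i : Fin 3) (h0 : p i) (h1 : p (i + 1))
    (h2 : p (i + 2)) : ∀ j, p j := by
  intro j
  have : j = i ∨ j = i + 1 ∨ j = i + 2 := by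
    clear * -
    decide +revert
  rcases this with rfl | rfl | rfl <;> assumption

lemma genAngle_of_degenerate {x : Fin 3 → ℝ} (hx : ∀ i, 0 < x i) {i : Fin 3}
    (h : x (i + 1) + x (i + 2) ≤ x i) :
    genAngle x i = Real.pi ∧ genAngle x (i + 1) = 0 ∧ genAngle x (i + 2) = 0 := by
  have h1 := hx (i + 1)
  have h2 := hx (i + 2)
  obtain ⟨-, -, -, e1, e2, e3, e4⟩ := fin_three_add i
  refine ⟨if_pos h, ?_, ?_⟩
  · rw [genAngle, e1, e2, if_neg (by linarith), if_pos (Or.inr (by linarith))]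
  · rw [genAngle, e3, e4, if_neg (by linarith), if_pos (Or.inl (by linarith))]

lemma genAngle_mem_angleTriangle {x : Fin 3 → ℝ} (hx : ∀ i, 0 < x i) :
    genAngle x ∈ angleTriangle := by
  by_cases h : ∀ i, x i < x (i + 1) + x (i + 2)
  · obtain ⟨h1, h2, -⟩ := genAngle_of_triangle hx h
    exact ⟨fun i => (h1 i).le, h2⟩
  · push Not at h
    obtain ⟨i, hi⟩ := h
    obtain ⟨g0, g1, g2⟩ := genAngle_of_degenerate hx hi
    refine ⟨forall_fin_three_cyclic i ?_ g1.ge g2.ge, ?_⟩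
    · rw [g0]; exact Real.pi_nonneg
    · rw [sum_fin_three_cyclic _ i, g0, g1, g2]; ring

/-- The Legendre transform pairing of the logarithmic side lengths with the volume. -/
def idealPairing (y a : Fin 3 → ℝ) : ℝ := 2 * idealVol a + ∑ i, y i * a i

/-- The angles of the generalized Euclidean triangle with side lengths `exp (y i / 2)`. -/
def expAngle (y : Fin 3 → ℝ) : Fin 3 → ℝ := genAngle fun i => Real.exp (y i / 2)

lemma expAngle_mem (y : Fin 3 → ℝ) : expAngle y ∈ angleTriangle :=
  genAngle_mem_angleTriangle fun _ => Real.exp_pos _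

/-- By the sine law, `-log (2 sin aᵢ)` equals `-yᵢ / 2` plus a constant independent of `i`. The
constant drops out because both angle triples have sum `π`, leaving exactly the linear term of the
pairing. -/
lemma idealPairing_le_of_triangle {y b : Fin 3 → ℝ} (hb : b ∈ angleTriangle)
    (h : ∀ i, Real.exp (y i / 2) < Real.exp (y (i + 1) / 2) + Real.exp (y (i + 2) / 2)) :
    idealPairing y b ≤ idealPairing y (expAngle y) := by
  obtain ⟨hpos, hsum, r, hr, hsin⟩ := genAngle_of_triangle (fun i => Real.exp_pos (y i / 2)) h
  have key := idealVol_le_of_pos hpos hsum hb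
  change idealVol b ≤ idealVol (expAngle y) +
    ∑ i, (b i - expAngle y i) * -Real.log (2 * Real.sin (expAngle y i)) at key
  change ∀ i, Real.sin (expAngle y i) = _ at hsin
  have hlog : ∀ i, (b i - expAngle y i) * -Real.log (2 * Real.sin (expAngle y i)) =
      -Real.log (2 * r) * (b i - expAngle y i) + -(1 / 2) * (y i * b i)
        + 1 / 2 * (y i * expAngle y i) := by
    intro i
    rw [hsin, ← mul_assoc, Real.log_mul (by positivity) (Real.exp_ne_zero _), Real.log_exp]
    ring
  rw [Finset.sum_congr rfl fun i _ => hlog i, Finset.sum_add_distrib, Finset.sum_add_distrib,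
    ← Finset.mul_sum, ← Finset.mul_sum, ← Finset.mul_sum, Finset.sum_sub_distrib, hb.2,
    (expAngle_mem y).2] at key
  unfold idealPairing
  linarith

lemma continuous_idealPairing_expAngle_sub (b : Fin 3 → ℝ) :
    Continuous fun y => idealPairing y (expAngle y) - idealPairing y b := by
  have h1 : Continuous expAngle := continuous_genAngle_exp
  have h2 := continuous_idealVol
  unfold idealPairing
  fun_prop

/-- Slightly shrinking the longest side gives strict triangles converging to this one, and both
sides are continuous. -/
lemma idealPairing_le_of_eq {y b : Fin 3 → ℝ} (hb : b ∈ angleTriangle) {i : Fin 3}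
    (h : Real.exp (y i / 2) = Real.exp (y (i + 1) / 2) + Real.exp (y (i + 2) / 2)) :
    idealPairing y b ≤ idealPairing y (expAngle y) := by
  set z : ℝ → Fin 3 → ℝ := fun s => Function.update y i (y i - s) with hz
  have hzc : Continuous z := by fun_prop
  have hz0 : z 0 = y := by simp [hz]
  obtain ⟨e0, e0', -, e1, e2, e3, e4⟩ := fin_three_add i
  have q1 := Real.exp_pos (y (i + 1) / 2)
  have q2 := Real.exp_pos (y (i + 2) / 2)
  have ev1 : ∀ᶠ s in 𝓝 (0 : ℝ), Real.exp (z s (i + 1) / 2) <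
      Real.exp (z s (i + 2) / 2) + Real.exp (z s i / 2) := by
    refine ContinuousAt.eventually_lt (by fun_prop) (by fun_prop) ?_
    rw [hz0]; linarith
  have ev2 : ∀ᶠ s in 𝓝 (0 : ℝ), Real.exp (z s (i + 2) / 2) <
      Real.exp (z s i / 2) + Real.exp (z s (i + 1) / 2) := by
    refine ContinuousAt.eventually_lt (by fun_prop) (by fun_prop) ?_
    rw [hz0]; linarith
  have hev : ∀ᶠ s in 𝓝[>] (0 : ℝ),
      0 ≤ idealPairing (z s) (expAngle (z s)) - idealPairing (z s) b := by
    filter_upwards [ev1.filter_mono nhdsWithin_le_nhds, ev2.filter_mono nhdsWithin_le_nhds,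
      self_mem_nhdsWithin] with s h1 h2 hs
    refine sub_nonneg.2 (idealPairing_le_of_triangle hb (forall_fin_three_cyclic i ?_ ?_ ?_))
    · simp only [hz, Function.update_self, Function.update_of_ne e0, Function.update_of_ne e0']
      rw [← h]
      exact Real.exp_lt_exp.2 (by linarith [mem_Ioi.1 hs])
    · rwa [e1, e2]
    · rwa [e3, e4]
  have := ge_of_tendsto
    (((continuous_idealPairing_expAngle_sub b).comp hzc).continuousWithinAt (s := Ioi 0) (x := 0)) hev
  simpa [hz0] using this

/-- The angles of the generalized Euclidean triangle maximize the pairing. -/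
lemma idealPairing_le {b : Fin 3 → ℝ} (hb : b ∈ angleTriangle) (y : Fin 3 → ℝ) :
    idealPairing y b ≤ idealPairing y (expAngle y) := by
  by_cases h : ∀ i, Real.exp (y i / 2) < Real.exp (y (i + 1) / 2) + Real.exp (y (i + 2) / 2)
  · exact idealPairing_le_of_triangle hb h
  push Not at h
  obtain ⟨i, hi⟩ := h
  obtain ⟨e0, -, e0', -⟩ := fin_three_add i
  have q1 := Real.exp_pos (y (i + 1) / 2)
  have q2 : 0 < Real.exp (y i / 2) - Real.exp (y (i + 2) / 2) := by linarith
  -- One short side is lengthened until equality holds in the triangle inequality. The angles stay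
  -- `π, 0, 0`, so the right-hand side does not change, while the left-hand side can only grow.
  set z := Function.update y (i + 1) (2 * Real.log (Real.exp (y i / 2) - Real.exp (y (i + 2) / 2)))
    with hz
  have z0 : z i = y i := Function.update_of_ne e0.symm _ _
  have z2 : z (i + 2) = y (i + 2) := Function.update_of_ne e0' _ _
  have z1 : Real.exp (z (i + 1) / 2) = Real.exp (y i / 2) - Real.exp (y (i + 2) / 2) := by
    rw [hz, Function.update_self, mul_div_cancel_left₀ _ two_ne_zero, Real.exp_log q2]
  have hzi : Real.exp (z i / 2) = Real.exp (z (i + 1) / 2) + Real.exp (z (i + 2) / 2) := by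
    rw [z0, z1, z2]; ring
  have hle : y (i + 1) ≤ z (i + 1) := by
    have : Real.exp (y (i + 1) / 2) ≤ Real.exp (z (i + 1) / 2) := by rw [z1]; linarith
    linarith [Real.exp_le_exp.1 this]
  have key := idealPairing_le_of_eq hb hzi
  obtain ⟨a0, a1, a2⟩ := genAngle_of_degenerate (fun i => Real.exp_pos (z i / 2)) hzi.ge
  obtain ⟨b0, b1, b2⟩ := genAngle_of_degenerate (fun i => Real.exp_pos (y i / 2)) hi
  have hα : expAngle z = expAngle y := funext <| forall_fin_three_cyclic i (a0.trans b0.symm)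
    (a1.trans b1.symm) (a2.trans b2.symm)
  have hy1 : expAngle y (i + 1) = 0 := b1
  rw [hα] at key
  simp only [idealPairing, sum_fin_three_cyclic _ i, z0, z2, hy1, mul_zero] at key ⊢
  have := mul_le_mul_of_nonneg_right hle (hb.1 (i + 1))
  linarith

/-! ### Functions with a continuous field of subgradients -/

lemma contDiff_one_of_subgradient {E : Type*} [NormedAddCommGroup E] [NormedSpace ℝ E]
    {f : E → ℝ} {K : E → E →L[ℝ] ℝ} (hK : Continuous K)
    (h : ∀ x y, f x + K x (y - x) ≤ f y) : ContDiff ℝ 1 f := by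
  refine contDiff_one_iff_hasFDerivAt.2 ⟨K, hK, fun x => ?_⟩
  rw [hasFDerivAt_iff_isLittleO]
  refine Asymptotics.IsLittleO.of_bound fun c hc => ?_
  filter_upwards [Metric.continuousAt_iff'.1 hK.continuousAt c hc] with y hy
  rw [dist_eq_norm] at hy
  have h1 := h x y
  have h2 := h y x
  -- The two subgradient inequalities trap the linearization error between `0` and `(K y - K x) (y -
  -- x)`.
  have h3 : K y (x - y) = -K y (y - x) := by rw [← map_neg, neg_sub]
  have h4 : (K y - K x) (y - x) ≤ c * ‖y - x‖ :=
    ((le_abs_self _).trans ((K y - K x).le_opNorm _)).trans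
      (mul_le_mul_of_nonneg_right hy.le (norm_nonneg _))
  rw [sub_apply] at h4
  rw [Real.norm_eq_abs, abs_of_nonneg (by linarith)]
  linarith

lemma convexOn_univ_of_subgradient {E : Type*} [AddCommGroup E] [Module ℝ E]
    {f : E → ℝ} {K : E → E →ₗ[ℝ] ℝ} (h : ∀ x y, f x + K x (y - x) ≤ f y) :
    ConvexOn ℝ univ f := by
  refine ⟨convex_univ, fun x _ y _ u v hu hv huv => ?_⟩
  set c := u • x + v • y with hc
  have h1 := mul_le_mul_of_nonneg_left (h c x) hu
  have h2 := mul_le_mul_of_nonneg_left (h c y) hv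
  have h3 : u * K c (x - c) + v * K c (y - c) = 0 := by
    have e : u • (x - c) + v • (y - c) = 0 := by
      rw [smul_sub, smul_sub, sub_add_sub_comm, ← add_smul, huv, one_smul, ← hc, sub_self]
    rw [← smul_eq_mul, ← smul_eq_mul, ← map_smul, ← map_smul, ← map_add, e, map_zero]
  have h4 : (u + v) * f c = f c := by rw [huv, one_mul]
  simp only [smul_eq_mul]
  linarith

namespace Triangulation

variable {T : Type*} (𝒯 : Triangulation T)

/-! ### Angle assignments -/

/-- The sum of the lengths of the two edges of a quad. -/
def quadLength (l : 𝒯.Edge → ℝ) (q : T × Fin 3) : ℝ :=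
  l (𝒯.edge q.1 (quadFst q.2)) + l (𝒯.edge q.1 (quadSnd q.2))

lemma isAngleAssignment_iff {a : T × Fin 3 → ℝ} :
    𝒯.IsAngleAssignment a ↔ ∀ t, (fun i => a (t, i)) ∈ angleTriangle :=
  ⟨fun h t => ⟨fun i => h.1 (t, i), h.2 t⟩, fun h => ⟨fun q => (h q.1).1 q.2, fun t => (h t).2⟩⟩

lemma dihedral_eq_expAngle (l : 𝒯.Edge → ℝ) (t : T) :
    (fun i => 𝒯.dihedral l (t, i)) = expAngle fun i => 𝒯.quadLength l (t, i) := rfl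

lemma isAngleAssignment_dihedral (l : 𝒯.Edge → ℝ) : 𝒯.IsAngleAssignment (𝒯.dihedral l) :=
  𝒯.isAngleAssignment_iff.2 fun t => 𝒯.dihedral_eq_expAngle l t ▸ expAngle_mem _

lemma continuous_dihedral : Continuous 𝒯.dihedral := by
  refine continuous_pi fun q => ?_
  have h : Continuous fun l : 𝒯.Edge → ℝ => fun i => 𝒯.quadLength l (q.1, i) := by
    unfold quadLength
    fun_prop
  exact (continuous_apply q.2).comp (continuous_genAngle_exp.comp h)

lemma isCompact_setOf_isAngleAssignment : IsCompact {a | 𝒯.IsAngleAssignment a} := by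
  refine (isCompact_Icc (a := (0 : T × Fin 3 → ℝ)) (b := fun _ => Real.pi)).of_isClosed_subset
    ?_ fun a ha => ⟨ha.1, fun q => ?_⟩
  · simp only [IsAngleAssignment, ofPred_and, ofPred_forall]
    exact (isClosed_iInter fun q => isClosed_le continuous_const (by fun_prop)).inter
      (isClosed_iInter fun t => isClosed_eq (by fun_prop) continuous_const)
  · rw [← ha.2 q.1]
    exact Finset.single_le_sum (f := fun i => a (q.1, i)) (fun i _ => ha.1 _) (Finset.mem_univ q.2)

variable [Fintype T]

/-- Adjointness of the incidence pairing, which makes the covolume split over the tetrahedra. -/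
lemma sum_mul_coneAngle (l : 𝒯.Edge → ℝ) (a : T × Fin 3 → ℝ) :
    ∑ e, l e * 𝒯.coneAngle a e = ∑ q, 𝒯.quadLength l q * a q := by
  simp only [coneAngle, Finset.mul_sum]
  rw [Finset.sum_comm]
  refine Finset.sum_congr rfl fun q _ => ?_
  simp only [incidence, ← mul_assoc, ← Finset.sum_mul]
  congr 1
  classical
  simp [mul_add, Finset.sum_add_distrib, quadLength]

lemma vol_eq_sum_idealVol (a : T × Fin 3 → ℝ) :
    𝒯.vol a = ∑ t, idealVol fun i => a (t, i) := by
  simp only [vol, idealVol, Fintype.sum_prod_type]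

lemma continuous_coneAngle : Continuous 𝒯.coneAngle := by
  unfold coneAngle
  fun_prop

lemma coneAngle_combo (a b : T × Fin 3 → ℝ) (u v : ℝ) :
    𝒯.coneAngle (u • a + v • b) = u • 𝒯.coneAngle a + v • 𝒯.coneAngle b := by
  ext e
  simp only [coneAngle, Pi.add_apply, Pi.smul_apply, smul_eq_mul, Finset.mul_sum,
    ← Finset.sum_add_distrib]
  exact Finset.sum_congr rfl fun q _ => by ring

lemma continuous_vol : Continuous 𝒯.vol :=
  continuous_finsetSum _ fun q _ => continuous_lobachevsky.comp (continuous_apply q)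

lemma concaveOn_vol : ConcaveOn ℝ {a | 𝒯.IsAngleAssignment a} 𝒯.vol := by
  refine ⟨fun a ha b hb u v hu hv huv => ?_, fun a ha b hb u v hu hv huv => ?_⟩
  · simp only [mem_ofPred_eq, isAngleAssignment_iff] at *
    exact fun t => convex_angleTriangle (ha t) (hb t) hu hv huv
  · simp only [mem_ofPred_eq, isAngleAssignment_iff] at *
    simp only [vol_eq_sum_idealVol, smul_eq_mul, Finset.mul_sum, ← Finset.sum_add_distrib]
    exact Finset.sum_le_sum fun t _ => concaveOn_idealVol.2 (ha t) (hb t) hu hv huv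

/-! ### The covolume function -/

/-- The dihedral angles maximize the Legendre transform of the volume. -/
lemma two_mul_vol_add_le_cov (l : 𝒯.Edge → ℝ) {a : T × Fin 3 → ℝ} (ha : 𝒯.IsAngleAssignment a) :
    2 * 𝒯.vol a + ∑ e, l e * 𝒯.coneAngle a e ≤ 𝒯.cov l := by
  have h : ∀ b : T × Fin 3 → ℝ, 2 * 𝒯.vol b + ∑ e, l e * 𝒯.coneAngle b e =
      ∑ t, idealPairing (fun i => 𝒯.quadLength l (t, i)) fun i => b (t, i) := by
    intro b
    simp only [sum_mul_coneAngle, vol_eq_sum_idealVol, idealPairing, Finset.sum_add_distrib,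
      Finset.mul_sum, Fintype.sum_prod_type]
  rw [cov, h, h]
  exact Finset.sum_le_sum fun t _ => idealPairing_le (𝒯.isAngleAssignment_iff.1 ha t) _

/-- The cone angle of the dihedral angles, as a linear form. -/
def covGradient (l : 𝒯.Edge → ℝ) : (𝒯.Edge → ℝ) →L[ℝ] ℝ :=
  ∑ e, 𝒯.coneAngle (𝒯.dihedral l) e • ContinuousLinearMap.proj e

lemma continuous_covGradient : Continuous 𝒯.covGradient := by
  have := 𝒯.continuous_coneAngle.comp 𝒯.continuous_dihedral
  exact continuous_finsetSum _ fun e _ => ((continuous_apply e).comp this).smul continuous_const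

/-- The angles of `l` compete in the maximum defining `cov m`. -/
lemma cov_add_covGradient_le (l m : 𝒯.Edge → ℝ) :
    𝒯.cov l + 𝒯.covGradient l (m - l) ≤ 𝒯.cov m := by
  refine (le_of_eq ?_).trans (𝒯.two_mul_vol_add_le_cov m (𝒯.isAngleAssignment_dihedral l))
  simp only [cov, covGradient, sum_apply, smul_apply,
    ContinuousLinearMap.proj_apply, Pi.sub_apply, smul_eq_mul, mul_sub, Finset.sum_sub_distrib]
  simp only [mul_comm]
  ring

/-! ### Fenchel duality -/

/-- The epigraph of twice the negative volume, in terms of the cone angle. -/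
def volEpigraph : Set ((𝒯.Edge → ℝ) × ℝ) :=
  {p | ∃ a, 𝒯.IsAngleAssignment a ∧ 𝒯.coneAngle a = p.1 ∧ -2 * 𝒯.vol a ≤ p.2}

lemma convex_volEpigraph : Convex ℝ 𝒯.volEpigraph := by
  rintro p ⟨a, ha, hap, hav⟩ q ⟨b, hb, hbq, hbv⟩ u v hu hv huv
  refine ⟨u • a + v • b, 𝒯.concaveOn_vol.1 ha hb hu hv huv, ?_, ?_⟩
  · rw [coneAngle_combo, hap, hbq]; rfl
  · have h1 := 𝒯.concaveOn_vol.2 ha hb hu hv huv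
    have h2 := mul_le_mul_of_nonneg_left hav hu
    have h3 := mul_le_mul_of_nonneg_left hbv hv
    simp only [Prod.snd_add, Prod.smul_snd, smul_eq_mul] at *
    linarith

-- The epigraph is a compact set, the graph over all angle assignments, plus a closed vertical ray.
open scoped Pointwise in
lemma isClosed_volEpigraph : IsClosed 𝒯.volEpigraph := by
  have hS : 𝒯.volEpigraph = ((fun a => (𝒯.coneAngle a, -2 * 𝒯.vol a)) ''
      {a | 𝒯.IsAngleAssignment a}) + ({0} ×ˢ Ici 0 : Set ((𝒯.Edge → ℝ) × ℝ)) := by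
    ext ⟨k, s⟩
    simp only [Set.mem_add]
    constructor
    · rintro ⟨a, ha, hk, hs⟩
      exact ⟨_, mem_image_of_mem _ ha, (0, s - -2 * 𝒯.vol a), ⟨rfl, sub_nonneg.2 hs⟩,
        Prod.ext (by simpa using hk) (by simp)⟩
    · rintro ⟨_, ⟨a, ha, rfl⟩, ⟨z, t⟩, ⟨hz, ht⟩, h⟩
      obtain rfl : z = 0 := hz
      have h1 := congr_arg Prod.fst h
      have h2 := congr_arg Prod.snd h
      simp only [Prod.fst_add, Prod.snd_add, add_zero] at h1 h2
      have ht' : 0 ≤ t := ht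
      exact ⟨a, ha, h1, by simp only [← h2]; linarith⟩
  rw [hS]
  exact (isClosed_singleton.prod isClosed_Ici).add_left_of_isCompact
    (𝒯.isCompact_setOf_isAngleAssignment.image
      (𝒯.continuous_coneAngle.prodMk (continuous_const.mul 𝒯.continuous_vol)))

/-- A point outside of the epigraph lies below some affine minorant given by the covolume. -/
lemma exists_le_sub_cov {k : 𝒯.Edge → ℝ} {r : ℝ} (h : (k, r) ∉ 𝒯.volEpigraph) :
    ∃ l : 𝒯.Edge → ℝ, r ≤ ∑ e, l e * k e - 𝒯.cov l := by
  classical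
  obtain ⟨φ, u, hφ, hu⟩ :=
    geometric_hahn_banach_closed_point 𝒯.convex_volEpigraph 𝒯.isClosed_volEpigraph h
  set c := φ (0, 1) with hc
  set l : 𝒯.Edge → ℝ := fun e => φ (Pi.single e 1, 0) with hl
  have hφ' : ∀ x s, φ (x, s) = ∑ e, l e * x e + c * s := by
    intro x s
    have h1 : (x, s) = ∑ e, x e • ((Pi.single e 1, 0) : (𝒯.Edge → ℝ) × ℝ) +
        s • ((0, 1) : (𝒯.Edge → ℝ) × ℝ) := by
      refine Prod.ext ?_ ?_
      · simp only [Prod.fst_add, Prod.fst_sum, Prod.smul_fst, smul_zero, add_zero]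
        exact pi_eq_sum_univ' x
      · simp [Prod.snd_sum]
    rw [h1, map_add, map_sum, map_smul]
    simp only [map_smul, smul_eq_mul, hl, hc]
    congr 1
    · exact Finset.sum_congr rfl fun e _ => mul_comm _ _
    · exact mul_comm _ _
  have hbound : ∀ a, 𝒯.IsAngleAssignment a → ∀ s, -2 * 𝒯.vol a ≤ s →
      ∑ e, l e * 𝒯.coneAngle a e + c * s < u := fun a ha s hs => by
    rw [← hφ']; exact hφ _ ⟨a, ha, rfl, hs⟩
  rw [hφ'] at hu
  -- The epigraph is unbounded upwards, so a functional bounded above on it cannot increase in the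
  -- last coordinate.
  have hc0 : c ≤ 0 := by
    by_contra! hc0
    set a := 𝒯.dihedral 0
    set K := ∑ e, l e * 𝒯.coneAngle a e
    have h1 := hbound a (𝒯.isAngleAssignment_dihedral 0) (max (-2 * 𝒯.vol a) ((u - K) / c))
      (le_max_left _ _)
    have h2 := mul_le_mul_of_nonneg_left (le_max_right (-2 * 𝒯.vol a) ((u - K) / c)) hc0.le
    rw [mul_div_cancel₀ _ hc0.ne'] at h2
    linarith
  rcases hc0.lt_or_eq with hc0 | hc0
  -- Non-vertical hyperplane: normalized to slope `-1`, it is tested at the dihedral angles of `l'`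
  -- itself, where `cov l'` is evaluated.
  · set l' : 𝒯.Edge → ℝ := fun e => l e / -c with hl'
    refine ⟨l', ?_⟩
    have h1 := hbound _ (𝒯.isAngleAssignment_dihedral l') _ le_rfl
    have h2 : ∀ x : 𝒯.Edge → ℝ, ∑ e, l e * x e = -c * ∑ e, l' e * x e := by
      intro x
      rw [Finset.mul_sum]
      refine Finset.sum_congr rfl fun e _ => ?_
      have := hc0.ne
      simp only [hl']
      field_simp
    rw [h2] at h1 hu
    have h3 := h1.trans hu
    have h4 : -c * (∑ e, l' e * 𝒯.coneAngle (𝒯.dihedral l') e + 2 * 𝒯.vol (𝒯.dihedral l')) <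
        -c * (∑ e, l' e * k e - r) := by linarith
    have h5 := lt_of_mul_lt_mul_left h4 (by linarith)
    rw [cov]
    linarith
  -- Vertical hyperplane: `l` alone separates `k` from all cone angles, with gap at least `δ`. As
  -- volume is bounded by `M`, a large multiple of `l` pushes the value past `r`; `m` makes `m δ`
  -- absorb `|r| + 2|M|`.
  · obtain ⟨M, hM⟩ := 𝒯.isCompact_setOf_isAngleAssignment.bddAbove_image
      𝒯.continuous_vol.continuousOn
    simp only [hc0, zero_mul, add_zero] at hu hbound
    set δ := ∑ e, l e * k e - u with hδ
    have hδ0 : 0 < δ := sub_pos.2 hu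
    set m := (|r| + 2 * |M|) / δ with hm
    have hm0 : 0 ≤ m := by positivity
    refine ⟨m • l, ?_⟩
    set a := 𝒯.dihedral (m • l)
    have ha : 𝒯.IsAngleAssignment a := 𝒯.isAngleAssignment_dihedral _
    have h1 := hbound a ha _ le_rfl
    have h2 : ∀ x : 𝒯.Edge → ℝ, ∑ e, (m • l) e * x e = m * ∑ e, l e * x e := fun x => by
      simp only [Finset.mul_sum, Pi.smul_apply, smul_eq_mul, mul_assoc]
    have h3 : m * δ = |r| + 2 * |M| := div_mul_cancel₀ _ hδ0.ne'
    have h4 : 𝒯.vol a ≤ M := hM (mem_image_of_mem _ ha)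
    have h5 := mul_le_mul_of_nonneg_left h1.le hm0
    have h6 : m * δ = m * ∑ e, l e * k e - m * u := by rw [hδ]; ring
    rw [cov, h2, h2]
    linarith [le_abs_self r, le_abs_self M]

lemma exists_isLeast_neg_vol {k : 𝒯.Edge → ℝ} (hk : k ∈ 𝒯.coneAngles) :
    ∃ m : ℝ, IsLeast ((fun a => -𝒯.vol a) '' 𝒯.angleAssignments k) m ∧
      𝒯.W k = ((2 * m : ℝ) : EReal) := by
  have hc : IsCompact (𝒯.angleAssignments k) :=
    𝒯.isCompact_setOf_isAngleAssignment.inter_right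
      (isClosed_eq 𝒯.continuous_coneAngle continuous_const)
  obtain ⟨m, hm⟩ :=
    (hc.image 𝒯.continuous_vol.neg).exists_isLeast (hk.image _)
  refine ⟨m, hm, ?_⟩
  rw [W, if_pos hk]
  exact congr_arg (fun x : ℝ => ((2 * x : ℝ) : EReal)) hm.csInf_eq

lemma fenchelDual_cov_apply (k : 𝒯.Edge → ℝ) :
    fenchelDual (fun l => ((𝒯.cov l : ℝ) : EReal)) k =
      ⨆ l : 𝒯.Edge → ℝ, ((∑ e, l e * k e - 𝒯.cov l : ℝ) : EReal) := by
  simp only [fenchelDual, EReal.coe_sub]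

lemma fenchelDual_cov : fenchelDual (fun l => ((𝒯.cov l : ℝ) : EReal)) = 𝒯.W := by
  ext k
  rw [fenchelDual_cov_apply]
  refine le_antisymm (iSup_le fun l => ?_) ?_
  · by_cases hk : k ∈ 𝒯.coneAngles
    · obtain ⟨m, ⟨⟨a, ⟨ha, hak⟩, rfl⟩, -⟩, hW⟩ := 𝒯.exists_isLeast_neg_vol hk
      rw [hW, EReal.coe_le_coe_iff]
      have := 𝒯.two_mul_vol_add_le_cov l ha
      rw [hak] at this
      linarith
    · rw [W, if_neg hk]
      exact le_top
  -- Testing against real `r` below `W k` treats finite and infinite values alike.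
  · refine EReal.ge_of_forall_gt_iff_ge.1 fun r hr => ?_
    have hnot : (k, r) ∉ 𝒯.volEpigraph := by
      rintro ⟨a, ha, hak, har⟩
      obtain ⟨m, hm, hW⟩ := 𝒯.exists_isLeast_neg_vol (k := k) ⟨a, ha, hak⟩
      have : m ≤ -𝒯.vol a := hm.2 (mem_image_of_mem _ ⟨ha, hak⟩)
      rw [hW, EReal.coe_lt_coe_iff] at hr
      simp only at har
      linarith
    obtain ⟨l, hl⟩ := 𝒯.exists_le_sub_cov hnot
    exact (EReal.coe_le_coe_iff.2 hl).trans
      (le_iSup (fun l : 𝒯.Edge → ℝ => ((∑ e, l e * k e - 𝒯.cov l : ℝ) : EReal)) l)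

lemma W_eq_iSup (k : 𝒯.Edge → ℝ) :
    𝒯.W k = ⨆ l : 𝒯.Edge → ℝ, ((∑ e, l e * k e - 𝒯.cov l : ℝ) : EReal) := by
  rw [← fenchelDual_cov, fenchelDual_cov_apply]

lemma lowerSemicontinuous_W : LowerSemicontinuous 𝒯.W := by
  rw [funext 𝒯.W_eq_iSup]
  refine lowerSemicontinuous_iSup fun l => Continuous.lowerSemicontinuous ?_
  exact continuous_coe_real_ereal.comp (by fun_prop)

lemma isConvexFun_W : IsConvexFun 𝒯.W := by
  have hle : ∀ (l k : 𝒯.Edge → ℝ), ((∑ e, l e * k e - 𝒯.cov l : ℝ) : EReal) ≤ 𝒯.W k :=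
    fun l k => 𝒯.W_eq_iSup k ▸
      le_iSup (fun l : 𝒯.Edge → ℝ => ((∑ e, l e * k e - 𝒯.cov l : ℝ) : EReal)) l
  refine ⟨fun k hk => ?_, fun x y a b ha hb hab => ?_⟩
  · have := hle 0 k
    rw [hk, le_bot_iff] at this
    exact EReal.coe_ne_bot _ this
  · rw [𝒯.W_eq_iSup (a • x + b • y)]
    refine iSup_le fun l => ?_
    have e : ∑ e, l e * (a • x + b • y) e - 𝒯.cov l =
        a * (∑ e, l e * x e - 𝒯.cov l) + b * (∑ e, l e * y e - 𝒯.cov l) := by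
      simp only [Pi.add_apply, Pi.smul_apply, smul_eq_mul, mul_add, Finset.sum_add_distrib,
        mul_sub, Finset.mul_sum, mul_left_comm (l _)]
      linear_combination 𝒯.cov l * hab
    rw [e, EReal.coe_add, EReal.coe_mul, EReal.coe_mul]
    exact add_le_add (mul_le_mul_of_nonneg_left (hle l x) (EReal.coe_nonneg.2 ha.le))
      (mul_le_mul_of_nonneg_left (hle l y) (EReal.coe_nonneg.2 hb.le))

end Triangulation

end PseudoThree

end

theorem mainTheorem4 {T : Type*} [Fintype T] (𝒯 : PseudoThree.Triangulation T) :
    ContDiff ℝ 1 𝒯.cov ∧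
    ConvexOn ℝ Set.univ 𝒯.cov ∧
    (∀ k ∈ 𝒯.coneAngles, ∃ m : ℝ,
      IsLeast ((fun a => -𝒯.vol a) '' 𝒯.angleAssignments k) m ∧
        𝒯.W k = ((2 * m : ℝ) : EReal)) ∧
    LowerSemicontinuous 𝒯.W ∧
    PseudoThree.IsConvexFun 𝒯.W ∧
    PseudoThree.fenchelDual (fun l => ((𝒯.cov l : ℝ) : EReal)) = 𝒯.W := by
  refine ⟨PseudoThree.contDiff_one_of_subgradient 𝒯.continuous_covGradient
      𝒯.cov_add_covGradient_le,
    PseudoThree.convexOn_univ_of_subgradient (K := fun l => (𝒯.covGradient l).toLinearMap)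
      𝒯.cov_add_covGradient_le,
    fun k hk => 𝒯.exists_isLeast_neg_vol hk, 𝒯.lowerSemicontinuous_W, 𝒯.isConvexFun_W,
    𝒯.fenchelDual_cov⟩
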